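/- Let $G_n$ ($n\ge 1$) be a sequence of simple graphs, $G_n$ having $n$ nodes, maximum degree $d_{\max}=d_{\max}(n)$ and restricted growth coefficient $\kappa=\kappa(n)$, i.e. $|B_{r+1}(i)|\le\kappa\,|B_r(i)|$ for every node $i$ and every integer $r\ge 1$, where $B_r(i)$ is the set of nodes at graph distance at most $r$ from $i$. Fix $p\in(0,1)$ and $\bar Y$. Each node $i$ has a potential response $Y_i(z)$ for every assignment $z\in\{0,1\}^n$, depending on $n$, with $Y_i(z)\in[0,\bar Y]$. Let $E_i^{\mathbf 1}$ (resp. $E_i^{\mathbf 0}$) be the full-neighborhood exposure event that all nodes of $B_1(i)$ are treated (resp. in control), and assume that $Y_i(z)=Y_i(\mathbf 1)$ on $E_i^{\mathbf 1}$ and $Y_i(z)=Y_i(\mathbf 0)$ on $E_i^{\mathbf 0}$. Randomized graph cluster randomization (RGCR) with 1-hop-max draws i.i.d. $X_i\sim\mathcal U(0,1)$, lets the clusters be the classes of nodes with the same value of $\max_{j\in B_1(i)}X_j$, and assigns whole clusters to treatment or control, by one of the following: - independent randomization: given the clustering, each cluster is treated independently with probability $p$; - complete randomization: given a clustering with $K$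 clusters, a uniformly random set of $pK$ clusters is treated, where a non-integral $pK$ is rounded to $\lfloor pK\rfloor$ or $\lceil pK\rceil$ by an arbitrary rule, possibly random, whose law depends only on $n$ and $K$. Let $\hat\tau_{\mathcal P}$ be the Horvitz--Thompson estimator of the global average treatment effect, $$\hat\tau_{\mathcal P}=\frac1n\sum_{i=1}^n\left(\frac{\mathbb 1[E_i^{\mathbf 1}]\,Y_i(z)}{\mathbb P[E_i^{\mathbf 1}\mid\mathcal P]}-\frac{\mathbb 1[E_i^{\mathbf 0}]\,Y_i(z)}{\mathbb P[E_i^{\mathbf 0}\mid\mathcal P]}\right),$$ where $z$ is the realized assignment, the exposure probabilities are taken over both the random clustering and the cluster-level randomization, and a term whose event has probability $0$ is read as $0$. If either 1. $\kappa$ is fixed (independent of $n$) and $d_{\max}=o(n^{1/2})$, or 2. $\kappa=o(n^{1/6})$ and $d_{\max}=o(n^{1/6})$, then $\operatorname{Var}[\hat\tau_{\mathcal P}]\to 0$ as $n\to\infty$, under independent randomization and under complete randomization. -/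

import Mathlib

open MeasureTheory ProbabilityTheory Filter Topology Asymptotics
open scoped ENNReal

namespace RGCR

section Graph

variable {V : Type*} [Fintype V]

open Classical in
/-- The closed ball `B_r(i)`: all nodes at graph distance at most `r` from `i` (including `i`). -/
noncomputable def ball (G : SimpleGraph V) (r : ℕ) (i : V) : Finset V :=
  Finset.univ.filter fun j => G.edist i j ≤ (r : ℕ∞)

theorem mem_ball {G : SimpleGraph V} {r : ℕ} {i j : V} :
    j ∈ ball G r i ↔ G.edist i j ≤ (r : ℕ∞) := by
  simp [ball]

theorem ball_nonempty (G : SimpleGraph V) (r : ℕ) (i : V) : (ball G r i).Nonempty :=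
  ⟨i, by simp [mem_ball]⟩

/-- `κ` is a restricted growth coefficient of `G`: `|B_{r+1}(i)| ≤ κ |B_r(i)|` for all `r ≥ 1`. -/
def HasRestrictedGrowth (G : SimpleGraph V) (κ : ℝ) : Prop :=
  ∀ (i : V) (r : ℕ), 1 ≤ r → ((ball G (r + 1) i).card : ℝ) ≤ κ * ((ball G r i).card : ℝ)

end Graph

section Clustering

variable {V : Type*} [Fintype V]

/-- The label of node `i` under 1-hop-max: the maximum of `X` over `B_1(i)`. -/
noncomputable def oneHopMax (G : SimpleGraph V) (X : V → ℝ) (i : V) : ℝ :=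
  (ball G 1 i).sup' (ball_nonempty G 1 i) X

open Classical in
/-- The clustering (partition of the nodes) defined by a labelling `c`:
nodes with the same label form a single cluster. -/
noncomputable def clusters (c : V → ℝ) : Finset (Finset V) :=
  Finset.univ.image fun i => Finset.univ.filter fun j => c j = c i

end Clustering

section Randomization

variable {α : Type*}

open Classical in
/-- Independent randomization of a finite set `S` of clusters: the set of treated clusters, when
each element of `S` is treated independently with probability `p`. -/
noncomputable def independent (p : ℝ) (hp : p ∈ Set.Ioo (0 : ℝ) 1) (S : Finset α) :
    PMF (Finset α) :=
  PMF.ofFinset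
    (fun T => if T ⊆ S then
      ENNReal.ofReal p ^ T.card * ENNReal.ofReal (1 - p) ^ (S.card - T.card) else 0)
    S.powerset
    (by
      have h1 : ENNReal.ofReal p + ENNReal.ofReal (1 - p) = 1 := by
        rw [← ENNReal.ofReal_add hp.1.le (by linarith [hp.2])]
        simp
      rw [Finset.sum_congr rfl fun T hT => if_pos (Finset.mem_powerset.1 hT),
        Finset.sum_pow_mul_eq_add_pow, h1, one_pow])
    (by
      intro T hT
      rw [if_neg fun h => hT (Finset.mem_powerset.2 h)])

/-- A rule choosing the number of treated clusters among `K` clusters in complete randomization: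
`p K` clusters are treated, where a non-integral `p K` is rounded up or down (in a deterministic or
in a random way). -/
def IsCompleteRule (p : ℝ) (N : ℕ → PMF ℕ) : Prop :=
  ∀ K : ℕ, ∀ m ∈ (N K).support, m = ⌊p * (K : ℝ)⌋₊ ∨ m = ⌈p * (K : ℝ)⌉₊

/-- Complete randomization of a finite set `S` of clusters: given the number `m` of treated
clusters, the set of treated clusters is uniform among the subsets of `S` of size `m`.
(The last branch is only reached for `m > |S|`.) -/
noncomputable def complete (N : ℕ → PMF ℕ) (S : Finset α) : PMF (Finset α) :=
  (N S.card).bind fun m =>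
    if h : (S.powersetCard m).Nonempty then PMF.uniformOfFinset (S.powersetCard m) h
    else PMF.pure ∅

end Randomization

section Design

variable {V : Type*} [Fintype V]

open Classical in
/-- The node-level assignment (`true`: treatment, `false`: control) when `T` is the set of
treated clusters. -/
noncomputable def assignment (T : Finset (Finset V)) : V → Bool :=
  fun i => decide (∃ C ∈ T, i ∈ C)

/-- The law of the assignment vector under RGCR with 1-hop-max clustering and the cluster-level
randomization `R`: i.i.d. uniform `X_i` on `(0, 1)` are drawn, the 1-hop-max clusters are formed,
and given the clustering the treated clusters are drawn from `R`. -/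
noncomputable def design (G : SimpleGraph V)
    (R : Finset (Finset V) → PMF (Finset (Finset V))) : Measure (V → Bool) :=
  (Measure.pi fun _ : V => (volume : Measure ℝ).restrict (Set.Ioo 0 1)).bind fun X =>
    ((R (clusters (oneHopMax G X))).map assignment).toMeasure

/-- Every function of the 1-hop-max clustering is a measurable function of `X`. -/
theorem measurable_clusters_fun {β : Type*} [MeasurableSpace β] (G : SimpleGraph V)
    (f : Finset (Finset V) → β) :
    Measurable fun X : V → ℝ => f (clusters (oneHopMax G X)) := by
  classical
  let : MeasurableSpace (Finset (Finset V)) := ⊤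
  have hm : ∀ i, Measurable fun X : V → ℝ => oneHopMax G X i := by
    intro i
    unfold oneHopMax
    have := Finset.measurable_sup' (ball_nonempty G 1 i) (f := fun j (X : V → ℝ) => X j) (fun j _ => measurable_pi_apply j)
    convert this using 1
    ext X; simp [Finset.sup'_apply]
  have hf : Measurable f := measurable_from_top
  refine hf.comp ?_
  let g : (V → ℝ) → (V → V → Prop) := fun X i j => oneHopMax G X j = oneHopMax G X i
  have hg : Measurable g := by
    refine measurable_pi_lambda _ fun i => measurable_pi_lambda _ fun j => ?_
    exact (measurableSet_eq_fun (hm j) (hm i)).mem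
  let h : (V → V → Prop) → Finset (Finset V) := fun r => Finset.univ.image fun i => Finset.univ.filter fun j => r i j
  have hh : Measurable h := by
    have : Countable (V → V → Prop) := Finite.to_countable
    exact measurable_of_countable h
  exact hh.comp hg

/-- The design is a genuine probability measure. -/
instance (G : SimpleGraph V) (R) : IsProbabilityMeasure (design G R) := by
  unfold design
  have : IsProbabilityMeasure ((volume : Measure ℝ).restrict (Set.Ioo 0 1)) := ⟨by simp⟩
  refine ⟨?_⟩
  rw [Measure.bind_apply MeasurableSet.univ]
  · simp
  · exact (measurable_clusters_fun G (fun S => ((R S).map assignment).toMeasure)).aemeasurable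

/-- `E_i^1` (for `b = true`) and `E_i^0` (for `b = false`): the assignments under which `i` is
full-neighborhood exposed to treatment, respectively control. -/
def exposed (G : SimpleGraph V) (b : Bool) (i : V) : Set (V → Bool) :=
  {z | ∀ j ∈ ball G 1 i, z j = b}

/-- The potential outcomes `Y i z` follow the full-neighborhood exposure model: whenever `i` is
full-neighborhood exposed to treatment (control), its response is the one under global
treatment (control). -/
def FullNeighborhoodExposure (G : SimpleGraph V) (Y : V → (V → Bool) → ℝ) : Prop :=
  ∀ (i : V) (b : Bool), ∀ z ∈ exposed G b i, Y i z = Y i fun _ => b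

open Classical in
/-- The Horvitz–Thompson estimator of the mean outcome under global treatment (`b = true`) or
global control (`b = false`), as a function of the realized assignment `z`; the exposure
probabilities are those of the law `μ` of the assignment. -/
noncomputable def htMean (G : SimpleGraph V) (μ : Measure (V → Bool))
    (Y : V → (V → Bool) → ℝ) (b : Bool) (z : V → Bool) : ℝ :=
  (1 / (Fintype.card V : ℝ)) *
    ∑ i, (if z ∈ exposed G b i then Y i z / μ.real (exposed G b i) else 0)

/-- The Horvitz–Thompson estimator of the global average treatment effect (GATE). -/
noncomputable def htGATE (G : SimpleGraph V) (μ : Measure (V → Bool))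
    (Y : V → (V → Bool) → ℝ) (z : V → Bool) : ℝ :=
  htMean G μ Y true z - htMean G μ Y false z

/-- The variance of the HT GATE estimator under RGCR with 1-hop-max clustering and the
cluster-level randomization `R`. -/
noncomputable def varGATE (G : SimpleGraph V)
    (R : Finset (Finset V) → PMF (Finset (Finset V))) (Y : V → (V → Bool) → ℝ) : ℝ :=
  variance (htGATE G (design G R) Y) (design G R)

end Design

end RGCR

/-!
The exposure of a node `i` is decided by the `a_i` clusters that meet `B_1(i)`, and `a_i` depends
only on the variables of the nodes in `B_2(i)`. Under independent randomization `i` is exposed to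
an arm of probability `q` with probability `w_i = E[q ^ a_i]` (`idealProb`), and two nodes at
distance more than `4` are exposed independently: their `B_2`-balls are disjoint, so `a_i` and
`a_j` are independent and, as the variables are almost surely distinct, no cluster meets both
neighbourhoods.

Complete randomization is treated as a perturbation (`NearlyIndependent`). If `M` of `K` clusters
lie in an arm, where `|M - q K| ≤ 1`, then `a` given clusters all lie in that arm with probability
`M (M - 1) ⋯ (M - a + 1) / (K (K - 1) ⋯ (K - a + 1))`. This is at most `exp (a / (q K)) q ^ a`, and
at least `q ^ a (1 - a ^ 2 / (q K))`. Each cluster has at most `d_max + 1` nodes, so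
`K ≥ n / (d_max + 1)`, and since `a ≤ 2 (d_max + 1)` is `o(K)` the upper bound is `(1 + o(1)) q ^ a`
for all sets of clusters that occur (also when `K` depends on the same variables as `a`). The lower
bound is `(1 - o(1)) q ^ a` for `a ≤ n ^ (1 / 4)` only; larger values of `a` contribute at most
`q ^ (n ^ (1 / 4))` to `w_i`, which is negligible, as `w_i` is not less than a power of `1 / n`:
`i` has the largest variable in `B_2(i)` with probability `1 / |B_2(i)|` and then `a_i = 1`, so
`w_i ≥ q / |B_2(i)| ≥ q / (κ (d_max + 1))` (`ofReal_le_card_mul_idealProb`).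

In the variance of the estimator for one arm, pairs at distance more than `4` therefore contribute
`o(1)`. The other pairs, at most `n κ³ (d_max + 1)` in number, contribute at most
`Ybar² / P(E_i) = O(κ (d_max + 1))` each, before division by `n²` (`variance_htMean_le`). The total
is `o(1) + O(κ⁴ (d_max + 1)² / n)`, and both growth conditions give `κ⁴ (d_max + 1)² = o(n)`.
-/

namespace RGCR

/-! ### Balls and restricted growth -/

section Balls

variable {V : Type*} [Fintype V] {G : SimpleGraph V}

theorem self_mem_ball (G : SimpleGraph V) (r : ℕ) (i : V) : i ∈ ball G r i := by
  simp [mem_ball]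

theorem mem_ball_comm {r : ℕ} {i j : V} : j ∈ ball G r i ↔ i ∈ ball G r j := by
  rw [mem_ball, mem_ball, SimpleGraph.edist_comm]

theorem ball_subset_ball_add {r s : ℕ} {i j : V} (h : j ∈ ball G r i) :
    ball G s j ⊆ ball G (r + s) i := by
  intro k hk
  rw [mem_ball] at *
  calc G.edist i k ≤ G.edist i j + G.edist j k := SimpleGraph.edist_triangle
    _ ≤ (r : ℕ∞) + (s : ℕ∞) := add_le_add h hk
    _ = ((r + s : ℕ) : ℕ∞) := by push_cast; rfl

theorem ball_mono {r s : ℕ} (h : r ≤ s) (i : V) : ball G r i ⊆ ball G s i := by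
  intro k hk
  rw [mem_ball] at *
  exact hk.trans (by exact_mod_cast h)

theorem disjoint_ball_of_notMem {r s : ℕ} {i j : V} (h : j ∉ ball G (r + s) i) :
    Disjoint (ball G r i) (ball G s j) := by
  rw [Finset.disjoint_left]
  intro k hk hk'
  exact h (ball_subset_ball_add hk (mem_ball_comm.1 hk'))

theorem card_ball_pos (G : SimpleGraph V) (r : ℕ) (i : V) : 0 < (ball G r i).card :=
  Finset.card_pos.2 (ball_nonempty G r i)

theorem card_ball_one_le [DecidableRel G.Adj] (i : V) :
    (ball G 1 i).card ≤ G.maxDegree + 1 := by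
  classical
  have h : ball G 1 i ⊆ insert i (G.neighborFinset i) := by
    intro j hj
    rw [mem_ball, Nat.cast_one, SimpleGraph.edist_le_one_iff_adj_or_eq] at hj
    rcases hj with hj | rfl
    · exact Finset.mem_insert_of_mem (by simpa using hj)
    · exact Finset.mem_insert_self _ _
  calc (ball G 1 i).card ≤ (insert i (G.neighborFinset i)).card := Finset.card_le_card h
    _ ≤ (G.neighborFinset i).card + 1 := Finset.card_insert_le _ _
    _ ≤ G.maxDegree + 1 := by
      rw [SimpleGraph.card_neighborFinset_eq_degree]
      exact Nat.succ_le_succ (G.degree_le_maxDegree i)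

theorem HasRestrictedGrowth.one_le [Nonempty V] {κ : ℝ} (h : HasRestrictedGrowth G κ) :
    1 ≤ κ := by
  obtain ⟨i⟩ := ‹Nonempty V›
  have h1 := h i 1 le_rfl
  have h2 : ((ball G 1 i).card : ℝ) ≤ (ball G (1 + 1) i).card := by
    exact_mod_cast Finset.card_le_card (ball_mono (by norm_num) i)
  have h3 : (0 : ℝ) < (ball G 1 i).card := by exact_mod_cast card_ball_pos G 1 i
  by_contra! hlt
  nlinarith

theorem HasRestrictedGrowth.card_ball_le [DecidableRel G.Adj] {κ : ℝ}
    (h : HasRestrictedGrowth G κ) (i : V) (r : ℕ) :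
    ((ball G (r + 1) i).card : ℝ) ≤ κ ^ r * (G.maxDegree + 1 : ℝ) := by
  have : Nonempty V := ⟨i⟩
  have hκ := h.one_le
  induction r with
  | zero => simpa using (by exact_mod_cast card_ball_one_le i :
      ((ball G 1 i).card : ℝ) ≤ G.maxDegree + 1)
  | succ r ih =>
    calc ((ball G (r + 1 + 1) i).card : ℝ) ≤ κ * (ball G (r + 1) i).card := h i (r + 1) (by omega)
      _ ≤ κ * (κ ^ r * (G.maxDegree + 1 : ℝ)) := by gcongr
      _ = κ ^ (r + 1) * (G.maxDegree + 1 : ℝ) := by ring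

end Balls

/-! ### The clusters meeting a set of nodes -/

section Cells

variable {V : Type*} [Fintype V]

open Classical in
/-- The cluster of the node `j` in the clustering defined by the labelling `c`. -/
noncomputable def cell (c : V → ℝ) (j : V) : Finset V :=
  Finset.univ.filter fun k => c k = c j

open Classical in
/-- The clusters that meet the set of nodes `B`. -/
noncomputable def cells (c : V → ℝ) (B : Finset V) : Finset (Finset V) :=
  B.image (cell c)

theorem mem_cell {c : V → ℝ} {j k : V} : k ∈ cell c j ↔ c k = c j := by
  simp [cell]

theorem cell_eq_cell_iff {c : V → ℝ} {j k : V} : cell c j = cell c k ↔ c j = c k := by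
  refine ⟨fun h => ?_, fun h => ?_⟩
  · exact mem_cell.1 (h ▸ mem_cell.2 rfl : j ∈ cell c k)
  · ext l
    rw [mem_cell, mem_cell, h]

theorem clusters_eq_cells_univ (c : V → ℝ) : clusters c = cells c Finset.univ := rfl

theorem cells_subset_clusters (c : V → ℝ) (B : Finset V) : cells c B ⊆ clusters c := by
  classical
  exact Finset.image_subset_image (Finset.subset_univ B)

open Classical in
theorem card_cells (c : V → ℝ) (B : Finset V) : (cells c B).card = (B.image c).card := by
  have h : cells c B = (B.image c).image fun x => Finset.univ.filter fun k => c k = x := by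
    rw [Finset.image_image]; rfl
  rw [h, Finset.card_image_of_injOn]
  intro x hx y hy hxy
  obtain ⟨j, -, rfl⟩ := Finset.mem_image.1 (Finset.mem_coe.1 hx)
  obtain ⟨k, -, rfl⟩ := Finset.mem_image.1 (Finset.mem_coe.1 hy)
  exact cell_eq_cell_iff.1 hxy

open Classical in
theorem cells_union (c : V → ℝ) (A B : Finset V) : cells c (A ∪ B) = cells c A ∪ cells c B :=
  Finset.image_union _ _

/-- If the treated clusters are some of the clusters of `c`, a node is treated when its own cluster
is. -/
theorem assignment_apply {c : V → ℝ} {T : Finset (Finset V)} (hT : T ⊆ clusters c) (j : V) :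
    assignment T j = true ↔ cell c j ∈ T := by
  classical
  simp only [assignment, decide_eq_true_eq]
  constructor
  · rintro ⟨C, hC, hj⟩
    have hC' := hT hC
    rw [clusters, Finset.mem_image] at hC'
    obtain ⟨k, -, rfl⟩ := hC'
    have : cell c j = cell c k := cell_eq_cell_iff.2 (mem_cell.1 hj)
    rw [this]
    exact hC
  · exact fun h => ⟨_, h, mem_cell.2 rfl⟩

/-- The sets of treated clusters for which all clusters in `A` are assigned to the arm `b`. -/
def allAssigned {α : Type*} (b : Bool) (A : Finset α) : Set (Finset α) :=
  {T | ∀ C ∈ A, (C ∈ T ↔ b = true)}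

theorem forall_assignment_eq_iff {c : V → ℝ} {T : Finset (Finset V)} (hT : T ⊆ clusters c)
    (b : Bool) (B : Finset V) :
    (∀ j ∈ B, assignment T j = b) ↔ T ∈ allAssigned b (cells c B) := by
  classical
  simp only [allAssigned, Set.mem_ofPred_eq]
  rw [cells, Finset.forall_mem_image]
  refine forall₂_congr fun j _ => ?_
  rw [← assignment_apply hT j, Bool.eq_iff_iff]

end Cells

/-! ### Cluster-level randomization -/

section Randomization

variable {α : Type*}

/-- The marginal probability that a cluster is assigned to the arm `b`. -/
def armProb (p : ℝ) (b : Bool) : ℝ := bif b then p else 1 - p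

theorem armProb_mem_Ioo {p : ℝ} (hp : p ∈ Set.Ioo (0 : ℝ) 1) (b : Bool) :
    armProb p b ∈ Set.Ioo (0 : ℝ) 1 := by
  obtain ⟨h0, h1⟩ := hp
  cases b <;> constructor <;> simp [armProb] <;> linarith

theorem independent_allAssigned {p : ℝ} (hp : p ∈ Set.Ioo (0 : ℝ) 1) (b : Bool)
    {S A : Finset α} (hA : A ⊆ S) :
    (independent p hp S).toOuterMeasure (allAssigned b A) =
      ENNReal.ofReal (armProb p b) ^ A.card := by
  classical
  set x := ENNReal.ofReal p
  set y := ENNReal.ofReal (1 - p)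
  have hxy : x + y = 1 := by
    rw [← ENNReal.ofReal_add hp.1.le (by linarith [hp.2])]
    simp
  have hsum : (independent p hp S).toOuterMeasure (allAssigned b A) =
      ∑ T ∈ S.powerset, if T ∈ allAssigned b A then x ^ T.card * y ^ (S.card - T.card) else 0 := by
    rw [PMF.toOuterMeasure_apply, tsum_eq_sum (s := S.powerset)]
    · refine Finset.sum_congr rfl fun T hT => ?_
      simp only [Set.indicator_apply, independent, PMF.ofFinset_apply]
      rw [if_pos (Finset.mem_powerset.1 hT)]
    · intro T hT
      simp only [Set.indicator_apply, independent, PMF.ofFinset_apply]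
      rw [if_neg fun h => hT (Finset.mem_powerset.2 h), ite_self]
  rw [hsum, ← Finset.sum_filter]
  have hcard : (S \ A).card = S.card - A.card := Finset.card_sdiff_of_subset hA
  have hAS := Finset.card_le_card hA
  cases b with
  | true =>
    -- The sets `T` with `A ⊆ T ⊆ S` are the sets `U ∪ A` with `U ⊆ S \ A`.
    have hbij : (S.powerset.filter fun T => T ∈ allAssigned true A) =
        (S \ A).powerset.image (fun U => U ∪ A) := by
      ext T
      simp only [Finset.mem_filter, Finset.mem_powerset, allAssigned, Set.mem_ofPred_eq, iff_true,
        Finset.mem_image]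
      constructor
      · rintro ⟨h1, h2⟩
        exact ⟨T \ A, Finset.sdiff_subset_sdiff h1 subset_rfl, Finset.sdiff_union_of_subset h2⟩
      · rintro ⟨U, hU, rfl⟩
        exact ⟨Finset.union_subset (hU.trans Finset.sdiff_subset) hA,
          fun C hC => Finset.mem_union_right _ hC⟩
    have hdisj : ∀ U ∈ (S \ A).powerset, Disjoint U A := fun U hU =>
      (Finset.subset_sdiff.1 (Finset.mem_powerset.1 hU)).2
    rw [hbij, Finset.sum_image]
    · calc _ = ∑ U ∈ (S \ A).powerset, x ^ A.card * (x ^ U.card * y ^ ((S \ A).card - U.card)) := by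
            refine Finset.sum_congr rfl fun U hU => ?_
            rw [Finset.card_union_of_disjoint (hdisj U hU), hcard, pow_add,
              Nat.sub_sub, add_comm A.card]
            ring
        _ = x ^ A.card := by
            rw [← Finset.mul_sum, Finset.sum_pow_mul_eq_add_pow, hxy, one_pow, mul_one]
        _ = _ := by simp [armProb, x]
    · intro U hU U' hU' h
      have h' : (U ∪ A) \ A = (U' ∪ A) \ A := by simp only at h; rw [h]
      rwa [Finset.union_sdiff_cancel_right (hdisj U hU),
        Finset.union_sdiff_cancel_right (hdisj U' hU')] at h'
  | false =>
    have hset : (S.powerset.filter fun T => T ∈ allAssigned false A) = (S \ A).powerset := by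
      ext T
      simp only [Finset.mem_filter, Finset.mem_powerset, allAssigned, Set.mem_ofPred_eq,
        Bool.false_eq_true, iff_false, Finset.subset_sdiff, Finset.disjoint_right]
    rw [hset]
    calc _ = ∑ U ∈ (S \ A).powerset, y ^ A.card * (x ^ U.card * y ^ ((S \ A).card - U.card)) := by
          refine Finset.sum_congr rfl fun U hU => ?_
          have hU' := Finset.card_le_card (Finset.mem_powerset.1 hU)
          have : S.card - U.card = A.card + ((S \ A).card - U.card) := by omega
          rw [this, pow_add]
          ring
      _ = y ^ A.card := by
          rw [← Finset.mul_sum, Finset.sum_pow_mul_eq_add_pow, hxy, one_pow, mul_one]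
      _ = _ := by simp [armProb, y]

theorem independent_support_subset {p : ℝ} (hp : p ∈ Set.Ioo (0 : ℝ) 1) {S T : Finset α}
    (hT : T ∈ (independent p hp S).support) : T ⊆ S := by
  by_contra h
  exact (PMF.mem_support_iff _ _).1 hT (by simp [independent, PMF.ofFinset_apply, h])

/-- The number of clusters assigned to the arm `b` when `m` of `K` clusters are treated. -/
def armCount (K m : ℕ) (b : Bool) : ℕ := bif b then m else K - m

/-- Under complete randomization with `m` treated clusters, `a` given clusters all lie in an arm
of `M` clusters with probability `M (M - 1) ⋯ (M - a + 1) / (K (K - 1) ⋯ (K - a + 1))`. -/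
theorem uniformOfFinset_allAssigned {S A : Finset α} (hA : A ⊆ S) (b : Bool) {m : ℕ}
    (hm : m ≤ S.card) (h : (S.powersetCard m).Nonempty) :
    (PMF.uniformOfFinset (S.powersetCard m) h).toOuterMeasure (allAssigned b A) =
      ENNReal.ofReal (((armCount S.card m b).descFactorial A.card : ℝ) /
        (S.card.descFactorial A.card : ℝ)) := by
  classical
  have hAS := Finset.card_le_card hA
  have hchoose : (0 : ℝ) < S.card.choose m := by exact_mod_cast Nat.choose_pos hm
  have hdesc : (0 : ℝ) < S.card.descFactorial A.card := by
    exact_mod_cast Nat.descFactorial_pos.2 hAS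
  rw [PMF.toOuterMeasure_uniformOfFinset_apply, Finset.card_powersetCard]
  have key : ((S.powersetCard m).filter fun T => T ∈ allAssigned b A).card *
      S.card.descFactorial A.card =
      (armCount S.card m b).descFactorial A.card * S.card.choose m := by
    cases b with
    | true =>
      have hset : ((S.powersetCard m).filter fun T => T ∈ allAssigned true A) =
          (S.powersetCard m).filter fun T => A ⊆ T := by
        refine Finset.filter_congr fun T _ => ?_
        simp [allAssigned, Finset.subset_iff]
      rw [hset]
      simp only [armCount, cond_true]
      rcases lt_or_ge m A.card with hlt | hle
      · rw [Nat.descFactorial_eq_zero_iff_lt.2 hlt, zero_mul, Finset.card_eq_zero.2, zero_mul]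
        refine Finset.filter_eq_empty_iff.2 fun T hT hAT => ?_
        have := Finset.card_le_card hAT
        rw [(Finset.mem_powersetCard.1 hT).2] at this
        omega
      · rw [Finset.card_filter_powersetCard_subset _ _ _ hA hle,
          Nat.descFactorial_eq_factorial_mul_choose, Nat.descFactorial_eq_factorial_mul_choose]
        have := Nat.choose_mul (n := S.card) hle
        calc _ = A.card.factorial *
              (S.card.choose A.card * (S.card - A.card).choose (m - A.card)) := by ring
          _ = _ := by rw [← this]; ring
    | false =>
      have hset : ((S.powersetCard m).filter fun T => T ∈ allAssigned false A) =
          (S \ A).powersetCard m := by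
        ext T
        simp only [Finset.mem_filter, Finset.mem_powersetCard, allAssigned, Set.mem_ofPred_eq,
          Bool.false_eq_true, iff_false, Finset.subset_sdiff, Finset.disjoint_right]
        tauto
      rw [hset, Finset.card_powersetCard, Finset.card_sdiff_of_subset hA]
      simp only [armCount, cond_false]
      rw [Nat.descFactorial_eq_factorial_mul_choose, Nat.descFactorial_eq_factorial_mul_choose]
      rcases lt_or_ge (S.card - m) A.card with hlt | hle
      · rw [Nat.choose_eq_zero_of_lt (show S.card - A.card < m by omega),
          Nat.choose_eq_zero_of_lt hlt]
        simp
      · have h1 := Nat.choose_mul (n := S.card) (k := A.card + m) (s := A.card) (by omega)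
        have h2 := Nat.choose_mul (n := S.card) (k := A.card + m) (s := m) (by omega)
        rw [Nat.add_sub_cancel_left] at h1
        rw [Nat.add_sub_cancel] at h2
        rw [Nat.choose_symm_add] at h1
        calc _ = A.card.factorial * (S.card.choose A.card * (S.card - A.card).choose m) := by ring
          _ = A.card.factorial * (S.card.choose m * (S.card - m).choose A.card) := by
            rw [← h1, ← h2]
          _ = _ := by ring
  have hcast : ((((S.powersetCard m).filter fun T => T ∈ allAssigned b A).card : ℕ) : ℝ) /
      S.card.choose m = ((armCount S.card m b).descFactorial A.card : ℝ) /
        (S.card.descFactorial A.card : ℝ) := by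
    rw [div_eq_div_iff hchoose.ne' hdesc.ne']
    exact_mod_cast key
  rw [← hcast, ENNReal.ofReal_div_of_pos hchoose, ENNReal.ofReal_natCast, ENNReal.ofReal_natCast]

theorem complete_support_subset {N : ℕ → PMF ℕ} {S T : Finset α}
    (hT : T ∈ (complete N S).support) : T ⊆ S := by
  rw [complete, PMF.mem_support_bind_iff] at hT
  obtain ⟨m, -, hm⟩ := hT
  split_ifs at hm with h
  · rw [PMF.mem_support_uniformOfFinset_iff, Finset.mem_powersetCard] at hm
    exact hm.1
  · rw [PMF.mem_support_pure_iff] at hm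
    simp [hm]

theorem IsCompleteRule.le {p : ℝ} (hp : p ∈ Set.Ioo (0 : ℝ) 1) {N : ℕ → PMF ℕ}
    (hN : IsCompleteRule p N) {K m : ℕ} (hm : m ∈ (N K).support) : m ≤ K := by
  have hle : p * (K : ℝ) ≤ K := by nlinarith [hp.2, Nat.cast_nonneg (α := ℝ) K]
  have hc : ⌈p * (K : ℝ)⌉₊ ≤ K := Nat.ceil_le.2 hle
  rcases hN K m hm with rfl | rfl
  · exact (Nat.floor_le_ceil _).trans hc
  · exact hc

theorem IsCompleteRule.armCount_bounds {p : ℝ} (hp : p ∈ Set.Ioo (0 : ℝ) 1) {N : ℕ → PMF ℕ}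
    (hN : IsCompleteRule p N) {K m : ℕ} (hm : m ∈ (N K).support) (b : Bool) :
    (armCount K m b : ℝ) ≤ armProb p b * K + 1 ∧ armProb p b * K ≤ armCount K m b + 1 := by
  have h0 : 0 ≤ p * (K : ℝ) := mul_nonneg hp.1.le (Nat.cast_nonneg K)
  have hmK := hN.le hp hm
  have h : (m : ℝ) ≤ p * K + 1 ∧ p * K ≤ m + 1 := by
    rcases hN K m hm with rfl | rfl
    · exact ⟨(Nat.floor_le h0).trans (by linarith), (Nat.lt_floor_add_one _).le⟩
    · exact ⟨(Nat.ceil_lt_add_one h0).le, (Nat.le_ceil _).trans (by linarith)⟩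
  cases b with
  | true => simpa [armCount, armProb] using h
  | false =>
    simp only [armCount, armProb, cond_false, Nat.cast_sub hmK]
    constructor <;> nlinarith [h.1, h.2]

theorem descFactorial_mul_pow_le {M K : ℕ} (hMK : M ≤ K) (a : ℕ) :
    M.descFactorial a * K ^ a ≤ M ^ a * K.descFactorial a := by
  induction a with
  | zero => simp
  | succ a ih =>
    have h : (M - a) * K ≤ M * (K - a) := by
      rw [Nat.sub_mul, Nat.mul_sub]
      have : a * M ≤ a * K := Nat.mul_le_mul_left a hMK
      rw [mul_comm M a]
      omega
    rw [Nat.descFactorial_succ, Nat.descFactorial_succ]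
    calc (M - a) * M.descFactorial a * K ^ (a + 1)
        = ((M - a) * K) * (M.descFactorial a * K ^ a) := by ring
      _ ≤ (M * (K - a)) * (M ^ a * K.descFactorial a) := Nat.mul_le_mul h ih
      _ = M ^ (a + 1) * ((K - a) * K.descFactorial a) := by ring

theorem descFactorial_div_le {M K a : ℕ} {q : ℝ} (hq : 0 < q) (hMK : M ≤ K) (haK : a ≤ K)
    (hK : 0 < K) (hM : (M : ℝ) ≤ q * K + 1) :
    (M.descFactorial a : ℝ) / K.descFactorial a ≤ Real.exp (a / (q * K)) * q ^ a := by
  have hK' : (0 : ℝ) < K := by exact_mod_cast hK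
  have hdesc : (0 : ℝ) < K.descFactorial a := by exact_mod_cast Nat.descFactorial_pos.2 haK
  calc (M.descFactorial a : ℝ) / K.descFactorial a ≤ (M : ℝ) ^ a / (K : ℝ) ^ a := by
        rw [div_le_div_iff₀ hdesc (by positivity)]
        exact_mod_cast descFactorial_mul_pow_le hMK a
    _ = ((M : ℝ) / K) ^ a := (div_pow _ _ _).symm
    _ ≤ (Real.exp (1 / (q * K)) * q) ^ a := by
        refine pow_le_pow_left₀ (by positivity) ?_ a
        calc (M : ℝ) / K ≤ (q * K + 1) / K := by gcongr
          _ = (1 / (q * K) + 1) * q := by field_simp; ring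
          _ ≤ Real.exp (1 / (q * K)) * q := by gcongr; exact Real.add_one_le_exp _
    _ = Real.exp (a / (q * K)) * q ^ a := by
        rw [mul_pow, ← Real.exp_nat_mul]
        congr 2
        ring

theorem le_descFactorial_div {M K a : ℕ} {q : ℝ} (hq : 0 < q) (haK : a ≤ K)
    (hK : 0 < K) (hM : q * K ≤ (M : ℝ) + 1) :
    q ^ a * (1 - a ^ 2 / (q * K)) ≤ (M.descFactorial a : ℝ) / K.descFactorial a := by
  have hK' : (0 : ℝ) < K := by exact_mod_cast hK
  have hdesc : (0 : ℝ) < K.descFactorial a := by exact_mod_cast Nat.descFactorial_pos.2 haK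
  have hqK : 0 < q * K := by positivity
  rcases le_or_gt (q * K) a with h | h
  · -- In this case the left-hand side is nonpositive.
    have ha : (1 : ℝ) ≤ a := by
      have : (0 : ℝ) < a := hqK.trans_le h
      exact_mod_cast (by exact_mod_cast this : 0 < a)
    have h1 : 1 ≤ (a : ℝ) ^ 2 / (q * K) := by
      rw [le_div_iff₀ hqK]
      nlinarith
    have h2 : q ^ a * (1 - a ^ 2 / (q * K)) ≤ 0 :=
      mul_nonpos_of_nonneg_of_nonpos (by positivity) (by linarith)
    exact h2.trans (by positivity)
  · have haM : a ≤ M + 1 := by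
      have : (a : ℝ) < ((M + 1 : ℕ) : ℝ) := by push_cast; linarith
      exact (by exact_mod_cast this : a < M + 1).le
    have ht : (a : ℝ) / (q * K) ≤ 1 := (div_le_one hqK).2 h.le
    calc q ^ a * (1 - a ^ 2 / (q * K)) = q ^ a * (1 + a * (-(a / (q * K)))) := by ring
      _ ≤ q ^ a * (1 + -(a / (q * K))) ^ a := by
          gcongr
          exact one_add_mul_le_pow (by linarith) a
      _ = ((q * K - a) / K) ^ a := by
          rw [← mul_pow]
          congr 1
          field_simp
          ring
      _ ≤ ((M + 1 - a : ℕ) / (K : ℝ)) ^ a := by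
          refine pow_le_pow_left₀ (div_nonneg (by linarith) hK'.le) ?_ a
          rw [Nat.cast_sub haM]
          push_cast
          gcongr
      _ = ((M + 1 - a) ^ a : ℕ) / (K : ℝ) ^ a := by push_cast; rw [div_pow]
      _ ≤ (M.descFactorial a : ℝ) / K.descFactorial a := by
          refine div_le_div₀ (by positivity) ?_ hdesc ?_
          · exact_mod_cast Nat.pow_sub_le_descFactorial M a
          · exact_mod_cast Nat.descFactorial_le_pow K a

/-- The randomization `R` assigns clusters to the arm `b` almost as if each of them was assigned to
it independently with probability `q`, for clusterings into at least `K₀` clusters. The upper bound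
holds for up to `D` clusters at a time. The lower bound is required only for up to `L` clusters,
since under complete randomization it fails for large sets of clusters. -/
structure NearlyIndependent (R : Finset α → PMF (Finset α)) (b : Bool) (q ε K₀ : ℝ)
    (D L : ℕ) : Prop where
  support_subset : ∀ S : Finset α, ∀ T ∈ (R S).support, T ⊆ S
  le : ∀ S A : Finset α, A ⊆ S → K₀ ≤ S.card → A.card ≤ D →
    (R S).toOuterMeasure (allAssigned b A) ≤ ENNReal.ofReal (1 + ε) * ENNReal.ofReal q ^ A.card
  ge : ∀ S A : Finset α, A ⊆ S → K₀ ≤ S.card → A.card ≤ L →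
    ENNReal.ofReal q ^ A.card ≤ ENNReal.ofReal (1 + ε) * (R S).toOuterMeasure (allAssigned b A)

theorem nearlyIndependent_independent {p : ℝ} (hp : p ∈ Set.Ioo (0 : ℝ) 1) (b : Bool)
    {ε : ℝ} (hε : 0 ≤ ε) (K₀ : ℝ) (D L : ℕ) :
    NearlyIndependent (independent (α := α) p hp) b (armProb p b) ε K₀ D L := by
  have h1 : (1 : ℝ≥0∞) ≤ ENNReal.ofReal (1 + ε) := by
    rw [← ENNReal.ofReal_one]
    exact ENNReal.ofReal_le_ofReal (by linarith)
  refine ⟨fun S T hT => independent_support_subset hp hT, fun S A hA _ _ => ?_,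
    fun S A hA _ _ => ?_⟩ <;> rw [independent_allAssigned hp b hA]
  · exact le_mul_of_one_le_left' h1
  · exact le_mul_of_one_le_left' h1

theorem toOuterMeasure_bind_le {β γ : Type*} {P : PMF β} {f : β → PMF γ} {s : Set γ}
    {c : ℝ≥0∞} (h : ∀ m ∈ P.support, (f m).toOuterMeasure s ≤ c) :
    (P.bind f).toOuterMeasure s ≤ c := by
  rw [PMF.toOuterMeasure_bind_apply]
  calc ∑' m, P m * (f m).toOuterMeasure s ≤ ∑' m, P m * c := by
        refine ENNReal.tsum_le_tsum fun m => ?_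
        by_cases hm : P m = 0
        · simp [hm]
        · exact mul_le_mul_right (h m ((P.mem_support_iff m).2 hm)) _
    _ = c := by rw [ENNReal.tsum_mul_right, P.tsum_coe, one_mul]

theorem le_mul_toOuterMeasure_bind {β γ : Type*} {P : PMF β} {f : β → PMF γ} {s : Set γ}
    {c d : ℝ≥0∞} (h : ∀ m ∈ P.support, d ≤ c * (f m).toOuterMeasure s) :
    d ≤ c * (P.bind f).toOuterMeasure s := by
  rw [PMF.toOuterMeasure_bind_apply]
  calc d = ∑' m, P m * d := by rw [ENNReal.tsum_mul_right, P.tsum_coe, one_mul]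
    _ ≤ ∑' m, c * (P m * (f m).toOuterMeasure s) := by
        refine ENNReal.tsum_le_tsum fun m => ?_
        by_cases hm : P m = 0
        · simp [hm]
        · rw [mul_left_comm]
          exact mul_le_mul_right (h m ((P.mem_support_iff m).2 hm)) _
    _ = _ := ENNReal.tsum_mul_left

/-- The two numerical conditions compare `exp (a / (q K))` for `a ≤ D`, and `1 - a ^ 2 / (q K)` for
`a ≤ L`, with `1 + ε`, when `K ≥ K₀`. -/
theorem nearlyIndependent_complete {p : ℝ} (hp : p ∈ Set.Ioo (0 : ℝ) 1) (b : Bool)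
    {N : ℕ → PMF ℕ} (hN : IsCompleteRule p N) {ε K₀ : ℝ} {D L : ℕ} (hε : 0 ≤ ε) (hK₀ : 0 < K₀)
    (hD : Real.exp (D / (armProb p b * K₀)) ≤ 1 + ε)
    (hL : 1 ≤ (1 + ε) * (1 - L ^ 2 / (armProb p b * K₀))) :
    NearlyIndependent (complete (α := α) N) b (armProb p b) ε K₀ D L := by
  have hq := (armProb_mem_Ioo hp b).1
  set q := armProb p b with hqdef
  have hunif : ∀ S A : Finset α, A ⊆ S → ∀ m ∈ (N S.card).support,
      (if h : (S.powersetCard m).Nonempty then PMF.uniformOfFinset (S.powersetCard m) h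
        else PMF.pure ∅).toOuterMeasure (allAssigned b A) =
      ENNReal.ofReal (((armCount S.card m b).descFactorial A.card : ℝ) /
        (S.card.descFactorial A.card : ℝ)) := by
    intro S A hA m hm
    have hmS := hN.le hp hm
    rw [dif_pos (Finset.powersetCard_nonempty.2 hmS)]
    exact uniformOfFinset_allAssigned hA b hmS _
  refine ⟨fun S T hT => complete_support_subset hT, fun S A hA hS hAD => ?_,
    fun S A hA hS hAL => ?_⟩
  · have hS' : (0 : ℝ) < S.card := hK₀.trans_le hS
    refine toOuterMeasure_bind_le fun m hm => ?_
    rw [hunif S A hA m hm, ← ENNReal.ofReal_pow hq.le, ← ENNReal.ofReal_mul (by linarith)]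
    refine ENNReal.ofReal_le_ofReal ?_
    have hM : armCount S.card m b ≤ S.card := by
      have := hN.le hp hm
      cases b <;> simp [armCount, this]
    refine (descFactorial_div_le hq hM (Finset.card_le_card hA) (by exact_mod_cast hS')
      (hN.armCount_bounds hp hm b).1).trans ?_
    gcongr
    refine le_trans (Real.exp_le_exp.2 ?_) hD
    gcongr
  · have hS' : (0 : ℝ) < S.card := hK₀.trans_le hS
    refine le_mul_toOuterMeasure_bind fun m hm => ?_
    rw [hunif S A hA m hm, ← ENNReal.ofReal_pow hq.le, ← ENNReal.ofReal_mul (by linarith)]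
    refine ENNReal.ofReal_le_ofReal ?_
    have h1 := le_descFactorial_div hq (Finset.card_le_card hA) (by exact_mod_cast hS')
      (hN.armCount_bounds hp hm b).2
    have h2 : (A.card : ℝ) ^ 2 / (q * S.card) ≤ L ^ 2 / (q * K₀) := by gcongr
    have hqa : 0 < q ^ A.card := by positivity
    calc q ^ A.card ≤ q ^ A.card * ((1 + ε) * (1 - L ^ 2 / (q * K₀))) :=
          le_mul_of_one_le_right hqa.le hL
      _ = (1 + ε) * (q ^ A.card * (1 - L ^ 2 / (q * K₀))) := by ring
      _ ≤ (1 + ε) * (q ^ A.card * (1 - A.card ^ 2 / (q * S.card))) := by gcongr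
      _ ≤ _ := by gcongr

end Randomization

/-! ### The 1-hop-max clustering -/

section OneHopMax

variable {V : Type*} [Fintype V]

/-- The law of the node variables: independent and uniform on `(0, 1)`. -/
noncomputable def nodeLaw (V : Type*) [Fintype V] : Measure (V → ℝ) :=
  Measure.pi fun _ : V => (volume : Measure ℝ).restrict (Set.Ioo 0 1)

instance : IsProbabilityMeasure ((volume : Measure ℝ).restrict (Set.Ioo 0 1)) := ⟨by simp⟩

instance : IsProbabilityMeasure (nodeLaw V) := by
  unfold nodeLaw
  infer_instance

/-- Ties have probability zero, so different nodes almost surely provide different labels. -/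
theorem ae_injective_nodeLaw : ∀ᵐ X ∂nodeLaw V, Function.Injective X := by
  classical
  have hpair : ∀ i j : V, i ≠ j → ∀ᵐ X ∂nodeLaw V, X i ≠ X j := by
    intro i j hij
    have habs : nodeLaw V ≪ (volume : Measure (V → ℝ)) := by
      rw [nodeLaw, ← Measure.restrict_pi_pi, ← volume_pi]
      exact Measure.absolutelyContinuous_of_le Measure.restrict_le_self
    suffices h : ∀ᵐ X ∂(volume : Measure (V → ℝ)), X i ≠ X j from habs.ae_le h
    -- The tuples with two equal coordinates form a proper subspace.
    let F : (V → ℝ) →ₗ[ℝ] ℝ :=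
      (LinearMap.proj i : (V → ℝ) →ₗ[ℝ] ℝ) - (LinearMap.proj j : (V → ℝ) →ₗ[ℝ] ℝ)
    have hF : LinearMap.ker F ≠ ⊤ := by
      intro h
      have : Pi.single i (1 : ℝ) ∈ LinearMap.ker F := h ▸ Submodule.mem_top
      simp [F, hij.symm] at this
    have h0 := Measure.addHaar_submodule (volume : Measure (V → ℝ)) (LinearMap.ker F) hF
    rw [ae_iff]
    convert h0 using 2
    ext X
    simp [F, sub_eq_zero]
  have hall : ∀ᵐ X ∂nodeLaw V, ∀ i j : V, i ≠ j → X i ≠ X j := by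
    refine ae_all_iff.2 fun i => ae_all_iff.2 fun j => ?_
    by_cases hij : i = j
    · simp [hij]
    · filter_upwards [hpair i j hij] with X hX _ using hX
  filter_upwards [hall] with X hX i j h
  by_contra hij
  exact hX i j hij h

theorem measurePreserving_comp_perm (σ : Equiv.Perm V) :
    MeasurePreserving (fun X : V → ℝ => X ∘ σ) (nodeLaw V) (nodeLaw V) := by
  have hm : Measurable fun X : V → ℝ => X ∘ σ :=
    measurable_pi_lambda _ fun i => measurable_pi_apply (σ i)
  refine ⟨hm, ?_⟩
  symm
  refine Measure.pi_eq fun s hs => ?_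
  rw [Measure.map_apply hm (MeasurableSet.univ_pi hs)]
  have hpre : (fun X : V → ℝ => X ∘ σ) ⁻¹' (Set.univ.pi s) = Set.univ.pi fun i => s (σ.symm i) := by
    ext X
    simp only [Set.mem_preimage, Set.mem_univ_pi, Function.comp_apply]
    exact ⟨fun h i => by simpa using h (σ.symm i), fun h i => by simpa using h (σ i)⟩
  rw [hpre, nodeLaw, Measure.pi_pi]
  exact Equiv.prod_comp σ.symm fun i => (volume : Measure ℝ).restrict (Set.Ioo 0 1) (s i)

/-- By symmetry, each node of `B` is the one with the largest variable in `B` with probability at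
least `1 / |B|`. -/
theorem one_le_card_mul_nodeLaw_isMax {B : Finset V} {i : V} (hi : i ∈ B) :
    1 ≤ (B.card : ℝ≥0∞) * nodeLaw V {X | ∀ j ∈ B, X j ≤ X i} := by
  classical
  have heq : ∀ k ∈ B, nodeLaw V {X | ∀ j ∈ B, X j ≤ X k} = nodeLaw V {X | ∀ j ∈ B, X j ≤ X i} := by
    intro k hk
    have hms : MeasurableSet {X : V → ℝ | ∀ j ∈ B, X j ≤ X i} := by
      have : {X : V → ℝ | ∀ j ∈ B, X j ≤ X i} = ⋂ j ∈ B, {X : V → ℝ | X j ≤ X i} := by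
        ext X; simp
      rw [this]
      exact B.measurableSet_biInter fun j _ =>
        measurableSet_le (measurable_pi_apply j) (measurable_pi_apply i)
    rw [← (measurePreserving_comp_perm (Equiv.swap i k)).measure_preimage hms.nullMeasurableSet]
    congr 1
    ext X
    simp only [Set.mem_ofPred_eq, Set.mem_preimage, Function.comp_apply, Equiv.swap_apply_left]
    have hswap : ∀ j ∈ B, Equiv.swap i k j ∈ B := by
      intro j hj
      by_cases h1 : j = i
      · simpa [h1] using hk
      · by_cases h2 : j = k
        · simpa [h2] using hi
        · rwa [Equiv.swap_apply_of_ne_of_ne h1 h2]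
    exact ⟨fun h j hj => h _ (hswap j hj), fun h j hj => by simpa using h _ (hswap j hj)⟩
  have hcover : (Set.univ : Set (V → ℝ)) ⊆ ⋃ k ∈ B, {X | ∀ j ∈ B, X j ≤ X k} := by
    intro X _
    obtain ⟨k, hk, hmax⟩ := B.exists_max_image X ⟨i, hi⟩
    exact Set.mem_biUnion hk hmax
  calc (1 : ℝ≥0∞) = nodeLaw V Set.univ := measure_univ.symm
    _ ≤ nodeLaw V (⋃ k ∈ B, {X | ∀ j ∈ B, X j ≤ X k}) := measure_mono hcover
    _ ≤ ∑ k ∈ B, nodeLaw V {X | ∀ j ∈ B, X j ≤ X k} := measure_biUnion_finset_le _ _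
    _ = B.card * nodeLaw V {X | ∀ j ∈ B, X j ≤ X i} := by
        rw [Finset.sum_congr rfl heq, Finset.sum_const, nsmul_eq_mul]

variable (G : SimpleGraph V)

/-- The number of 1-hop-max clusters that meet `B_1(i)`. -/
noncomputable def labelCount (X : V → ℝ) (i : V) : ℕ :=
  (cells (oneHopMax G X) (ball G 1 i)).card

theorem exists_oneHopMax_eq (X : V → ℝ) (j : V) : ∃ k ∈ ball G 1 j, oneHopMax G X j = X k :=
  Finset.exists_mem_eq_sup' _ X

theorem measurable_labelCount (i : V) : Measurable fun X => labelCount G X i := by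
  classical
  have h : ∀ X, labelCount G X i =
      ((clusters (oneHopMax G X)).filter fun C => ∃ j ∈ ball G 1 i, j ∈ C).card := by
    intro X
    unfold labelCount
    congr 1
    ext C
    rw [Finset.mem_filter]
    constructor
    · intro hC
      refine ⟨cells_subset_clusters _ _ hC, ?_⟩
      rw [cells, Finset.mem_image] at hC
      obtain ⟨j, hj, rfl⟩ := hC
      exact ⟨j, hj, mem_cell.2 rfl⟩
    · rintro ⟨hC, j, hj, hjC⟩
      rw [clusters_eq_cells_univ, cells, Finset.mem_image] at hC
      obtain ⟨k, -, rfl⟩ := hC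
      rw [cells, Finset.mem_image]
      exact ⟨j, hj, cell_eq_cell_iff.2 (mem_cell.1 hjC)⟩
  simp only [h]
  exact measurable_clusters_fun G fun S => (S.filter fun C => ∃ j ∈ ball G 1 i, j ∈ C).card

/-- The number of clusters that meet `B_1(i)` is determined by the variables of the nodes
in `B_2(i)`. -/
theorem labelCount_congr {X X' : V → ℝ} {i : V} (h : ∀ j ∈ ball G 2 i, X j = X' j) :
    labelCount G X i = labelCount G X' i := by
  classical
  unfold labelCount
  rw [card_cells, card_cells]
  congr 1
  refine Finset.image_congr fun j hj => ?_
  exact Finset.sup'_congr _ rfl fun k hk => h k (ball_subset_ball_add (s := 1) hj hk)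

theorem indepFun_labelCount {i j : V} (hij : j ∉ ball G 4 i) :
    IndepFun (fun X => labelCount G X i) (fun X => labelCount G X j) (nodeLaw V) := by
  classical
  have hind : iIndepFun (fun (k : V) (X : V → ℝ) => X k) (nodeLaw V) :=
    iIndepFun_pi (X := fun _ x => x) fun _ => aemeasurable_id
  have hfin := hind.indepFun_finset _ _ (disjoint_ball_of_notMem (r := 2) (s := 2) hij)
    fun k => measurable_pi_apply k
  -- Extension by zero exhibits each count as a measurable function of the restriction of `X`.
  let ext0 : (S : Finset V) → (S → ℝ) → V → ℝ := fun S x k => if h : k ∈ S then x ⟨k, h⟩ else 0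
  have hext : ∀ S : Finset V, Measurable (ext0 S) := by
    intro S
    refine measurable_pi_lambda _ fun k => ?_
    by_cases h : k ∈ S
    · simp only [ext0, h, dif_pos]
      exact measurable_pi_apply _
    · simp only [ext0, h, dif_neg, not_false_eq_true]
      exact measurable_const
  have hcomp := hfin.comp ((measurable_labelCount G i).comp (hext (ball G 2 i)))
    ((measurable_labelCount G j).comp (hext (ball G 2 j)))
  have hrestr : ∀ l : V, (fun X => labelCount G X l) =
      ((fun X => labelCount G X l) ∘ ext0 (ball G 2 l)) ∘
        fun X (k : ball G 2 l) => X k := by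
    intro l
    funext X
    refine labelCount_congr G fun k hk => ?_
    simp [ext0, hk]
  rw [hrestr i, hrestr j]
  exact hcomp

variable {G}

/-- If `i` has the largest variable in `B_2(i)`, all of `B_1(i)` lies in one cluster. -/
theorem labelCount_eq_one {X : V → ℝ} {i : V} (h : ∀ j ∈ ball G 2 i, X j ≤ X i) :
    labelCount G X i = 1 := by
  classical
  unfold labelCount
  rw [card_cells, Finset.card_eq_one]
  refine ⟨X i, ?_⟩
  rw [Finset.eq_singleton_iff_nonempty_unique_mem]
  refine ⟨(ball_nonempty G 1 i).image _, ?_⟩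
  simp only [Finset.mem_image]
  rintro _ ⟨j, hj, rfl⟩
  refine le_antisymm (Finset.sup'_le _ _ fun k hk => ?_) (Finset.le_sup' X (mem_ball_comm.1 hj))
  exact h k (ball_subset_ball_add (s := 1) hj hk)

/-- If the variables are distinct, the clusters meeting `B_1(i)` and those meeting `B_1(j)` are
different when `i` and `j` are at distance more than `4`. -/
theorem disjoint_cells {X : V → ℝ} (hX : Function.Injective X) {i j : V} (hij : j ∉ ball G 4 i) :
    Disjoint (cells (oneHopMax G X) (ball G 1 i)) (cells (oneHopMax G X) (ball G 1 j)) := by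
  classical
  rw [Finset.disjoint_left]
  intro C hC hC'
  rw [cells, Finset.mem_image] at hC hC'
  obtain ⟨k, hk, rfl⟩ := hC
  obtain ⟨l, hl, hkl⟩ := hC'
  rw [cell_eq_cell_iff] at hkl
  obtain ⟨k', hk', hkeq⟩ := exists_oneHopMax_eq G X k
  obtain ⟨l', hl', hleq⟩ := exists_oneHopMax_eq G X l
  have heq : k' = l' := hX (by rw [← hkeq, ← hleq, hkl])
  subst heq
  exact Finset.disjoint_left.1 (disjoint_ball_of_notMem (r := 2) (s := 2) hij)
    (ball_subset_ball_add (s := 1) hk hk') (ball_subset_ball_add (s := 1) hl hl')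

theorem labelCount_le [DecidableRel G.Adj] (X : V → ℝ) (i : V) :
    labelCount G X i ≤ G.maxDegree + 1 := by
  classical
  unfold labelCount
  rw [card_cells]
  exact Finset.card_image_le.trans (card_ball_one_le i)

/-- If the variables are distinct, every cluster lies in the neighbourhood of the node that provides
its label, so there are at least `n / (d_max + 1)` clusters. -/
theorem card_le_card_clusters_mul [DecidableRel G.Adj] {X : V → ℝ} (hX : Function.Injective X) :
    Fintype.card V ≤ (clusters (oneHopMax G X)).card * (G.maxDegree + 1) := by
  classical
  have hcard : ∀ C ∈ clusters (oneHopMax G X), C.card ≤ G.maxDegree + 1 := by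
    intro C hC
    rw [clusters_eq_cells_univ, cells, Finset.mem_image] at hC
    obtain ⟨j, -, rfl⟩ := hC
    obtain ⟨l, -, hleq⟩ := exists_oneHopMax_eq G X j
    refine le_trans (Finset.card_le_card fun k hk => ?_) (card_ball_one_le l)
    obtain ⟨l', hl', hleq'⟩ := exists_oneHopMax_eq G X k
    have : l' = l := hX (by rw [← hleq, ← hleq', mem_cell.1 hk])
    subst this
    exact mem_ball_comm.1 hl'
  have hcover : (Finset.univ : Finset V) ⊆ (clusters (oneHopMax G X)).biUnion id := by
    intro j _
    rw [Finset.mem_biUnion]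
    refine ⟨cell (oneHopMax G X) j, ?_, mem_cell.2 rfl⟩
    rw [clusters_eq_cells_univ, cells]
    exact Finset.mem_image_of_mem _ (Finset.mem_univ j)
  calc Fintype.card V = (Finset.univ : Finset V).card := rfl
    _ ≤ ((clusters (oneHopMax G X)).biUnion id).card := Finset.card_le_card hcover
    _ ≤ _ := Finset.card_biUnion_le_card_mul _ _ _ hcard

end OneHopMax

/-! ### Exposure probabilities -/

section Exposure

variable {V : Type*} [Fintype V] {G : SimpleGraph V}
  {R : Finset (Finset V) → PMF (Finset (Finset V))} {b : Bool} {q ε K₀ : ℝ} {D L : ℕ}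

theorem design_forall_eq (hR : ∀ S, ∀ T ∈ (R S).support, T ⊆ S) (b : Bool) (B : Finset V) :
    design G R {z | ∀ j ∈ B, z j = b} =
      ∫⁻ X, (R (clusters (oneHopMax G X))).toOuterMeasure
        (allAssigned b (cells (oneHopMax G X) B)) ∂nodeLaw V := by
  have hE : MeasurableSet {z : V → Bool | ∀ j ∈ B, z j = b} := (Set.toFinite _).measurableSet
  rw [design, Measure.bind_apply hE (measurable_clusters_fun G
    (fun S => ((R S).map assignment).toMeasure)).aemeasurable]
  refine lintegral_congr fun X => ?_
  rw [PMF.toMeasure_apply_eq_toOuterMeasure_apply _ hE, PMF.toOuterMeasure_map_apply]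
  refine PMF.toOuterMeasure_apply_eq_of_inter_support_eq _ ?_
  ext T
  simp only [Set.mem_inter_iff, Set.mem_preimage, Set.mem_ofPred_eq]
  refine and_congr_left fun hT => ?_
  exact forall_assignment_eq_iff (hR _ T hT) b B

theorem exposed_inter_exposed [DecidableEq V] (G : SimpleGraph V) (b : Bool) (i j : V) :
    exposed G b i ∩ exposed G b j = {z | ∀ k ∈ ball G 1 i ∪ ball G 1 j, z k = b} := by
  ext z
  simp only [exposed, Set.mem_inter_iff, Set.mem_ofPred_eq, Finset.mem_union]
  exact ⟨fun h k hk => hk.elim (h.1 k) (h.2 k),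
    fun h => ⟨fun k hk => h k (Or.inl hk), fun k hk => h k (Or.inr hk)⟩⟩

/-- The exposure probability of the node `i` if each cluster were assigned to an arm independently
with probability `q`: the expectation of `q ^ (number of clusters that meet B_1(i))`. -/
noncomputable def idealProb (G : SimpleGraph V) (q : ℝ) (i : V) : ℝ≥0∞ :=
  ∫⁻ X, ENNReal.ofReal q ^ labelCount G X i ∂nodeLaw V

theorem idealProb_le_one (hq : q ≤ 1) (i : V) : idealProb G q i ≤ 1 := by
  calc idealProb G q i ≤ ∫⁻ _, 1 ∂nodeLaw V := by
        refine lintegral_mono fun X => pow_le_one₀ zero_le ?_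
        rw [← ENNReal.ofReal_one]
        exact ENNReal.ofReal_le_ofReal hq
    _ = 1 := by simp

/-- With probability at least `1 / |B_2(i)|`, all of `B_1(i)` lies in one cluster. -/
theorem ofReal_le_card_mul_idealProb (G : SimpleGraph V) (q : ℝ) (i : V) :
    ENNReal.ofReal q ≤ ((ball G 2 i).card : ℝ≥0∞) * idealProb G q i := by
  set A := {X : V → ℝ | ∀ j ∈ ball G 2 i, X j ≤ X i}
  have h : ENNReal.ofReal q * nodeLaw V A ≤ idealProb G q i := by
    have hm : MeasurableSet {X | labelCount G X i = 1} :=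
      measurable_labelCount G i (measurableSet_singleton 1)
    calc ENNReal.ofReal q * nodeLaw V A
        ≤ ENNReal.ofReal q * nodeLaw V {X | labelCount G X i = 1} := by
          gcongr
          exact fun X hX => labelCount_eq_one hX
      _ = ∫⁻ _ in {X | labelCount G X i = 1}, ENNReal.ofReal q ∂nodeLaw V := by
          rw [setLIntegral_const]
      _ = ∫⁻ X in {X | labelCount G X i = 1}, ENNReal.ofReal q ^ labelCount G X i ∂nodeLaw V := by
          refine setLIntegral_congr_fun hm fun X hX => ?_
          have hX' : labelCount G X i = 1 := hX
          simp only [hX', pow_one]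
      _ ≤ idealProb G q i := setLIntegral_le_lintegral _ _
  calc ENNReal.ofReal q = ENNReal.ofReal q * 1 := (mul_one _).symm
    _ ≤ ENNReal.ofReal q * (((ball G 2 i).card : ℝ≥0∞) * nodeLaw V A) := by
        gcongr
        exact one_le_card_mul_nodeLaw_isMax (self_mem_ball G 2 i)
    _ = ((ball G 2 i).card : ℝ≥0∞) * (ENNReal.ofReal q * nodeLaw V A) := by ring
    _ ≤ _ := by gcongr

variable [DecidableRel G.Adj]

theorem ae_le_card_clusters (hK : K₀ * (G.maxDegree + 1) ≤ Fintype.card V) :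
    ∀ᵐ X ∂nodeLaw V, K₀ ≤ (clusters (oneHopMax G X)).card := by
  filter_upwards [ae_injective_nodeLaw] with X hX
  have h : (Fintype.card V : ℝ) ≤ (clusters (oneHopMax G X)).card * (G.maxDegree + 1) := by
    exact_mod_cast card_le_card_clusters_mul hX
  exact le_of_mul_le_mul_right (hK.trans h) (by positivity)

/-- A lower bound on the exposure probability. The outcomes with more than `L` clusters meeting
`B_1(i)`, on which `R` is not controlled from below, account for the term `q ^ L`. -/
theorem idealProb_le (hR : NearlyIndependent R b q ε K₀ D L)
    (hK : K₀ * (G.maxDegree + 1) ≤ Fintype.card V) (hq : q ≤ 1) (i : V) :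
    idealProb G q i ≤
      ENNReal.ofReal q ^ L + ENNReal.ofReal (1 + ε) * design G R (exposed G b i) := by
  have hq1 : ENNReal.ofReal q ≤ 1 := by
    rw [← ENNReal.ofReal_one]
    exact ENNReal.ofReal_le_ofReal hq
  rw [exposed, design_forall_eq hR.support_subset, ← lintegral_const_mul' _ _ ENNReal.ofReal_ne_top]
  have hconst : ENNReal.ofReal q ^ L = ∫⁻ _, ENNReal.ofReal q ^ L ∂nodeLaw V := by simp
  rw [hconst, ← lintegral_add_left measurable_const]
  refine lintegral_mono_ae ?_
  filter_upwards [ae_le_card_clusters hK] with X hX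
  rcases le_or_gt (labelCount G X i) L with h | h
  · exact (hR.ge _ _ (cells_subset_clusters _ _) hX h).trans le_add_self
  · exact (pow_le_pow_right_of_le_one' hq1 h.le).trans le_self_add

/-- At distance more than `4`, the numbers of clusters that meet the two neighbourhoods are
independent, and no cluster meets both. -/
theorem design_inter_exposed_le (hR : NearlyIndependent R b q ε K₀ D L)
    (hK : K₀ * (G.maxDegree + 1) ≤ Fintype.card V) (hD : 2 * (G.maxDegree + 1) ≤ D)
    {i j : V} (hij : j ∉ ball G 4 i) :
    design G R (exposed G b i ∩ exposed G b j) ≤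
      ENNReal.ofReal (1 + ε) * (idealProb G q i * idealProb G q j) := by
  classical
  have hmeas : ∀ k, Measurable fun X => ENNReal.ofReal q ^ labelCount G X k := fun k =>
    (measurable_from_top (f := fun a : ℕ => ENNReal.ofReal q ^ a)).comp (measurable_labelCount G k)
  have hind : IndepFun (fun X => ENNReal.ofReal q ^ labelCount G X i)
      (fun X => ENNReal.ofReal q ^ labelCount G X j) (nodeLaw V) :=
    (indepFun_labelCount G hij).comp
      (measurable_from_top (f := fun a : ℕ => ENNReal.ofReal q ^ a))
      (measurable_from_top (f := fun a : ℕ => ENNReal.ofReal q ^ a))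
  rw [idealProb, idealProb, ← lintegral_mul_eq_lintegral_mul_lintegral_of_indepFun''
    (hmeas i).aemeasurable (hmeas j).aemeasurable hind,
    ← lintegral_const_mul' _ _ ENNReal.ofReal_ne_top, exposed_inter_exposed,
    design_forall_eq hR.support_subset]
  refine lintegral_mono_ae ?_
  filter_upwards [ae_le_card_clusters hK, ae_injective_nodeLaw] with X hX hinj
  have hcard : (cells (oneHopMax G X) (ball G 1 i ∪ ball G 1 j)).card =
      labelCount G X i + labelCount G X j := by
    rw [cells_union, Finset.card_union_of_disjoint (disjoint_cells hinj hij)]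
    rfl
  refine (hR.le _ _ (cells_subset_clusters _ _) hX ?_).trans_eq ?_
  · rw [hcard]
    have h1 := labelCount_le (G := G) X i
    have h2 := labelCount_le (G := G) X j
    omega
  · rw [hcard, pow_add]

end Exposure

/-! ### The variance of the Horvitz–Thompson estimator -/

section Variance

variable {V : Type*} [Fintype V] {G : SimpleGraph V}

theorem measurableSet_exposed (b : Bool) (i : V) : MeasurableSet (exposed G b i) :=
  (Set.toFinite _).measurableSet

theorem memLp_of_finite {μ : Measure (V → Bool)} [IsFiniteMeasure μ] (f : (V → Bool) → ℝ) :
    MemLp f 2 μ := by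
  classical
  exact memLp_of_bounded (a := -∑ z, |f z|) (b := ∑ z, |f z|)
    (ae_of_all _ fun z => abs_le.1
      (Finset.single_le_sum (f := fun z => |f z|) (fun _ _ => abs_nonneg _) (Finset.mem_univ z)))
    (measurable_of_finite f).aestronglyMeasurable 2

theorem covariance_indicator_const {Ω : Type*} [MeasurableSpace Ω] {μ : Measure Ω}
    [IsProbabilityMeasure μ] {E F : Set Ω} (hE : MeasurableSet E) (hF : MeasurableSet F)
    (a c : ℝ) :
    cov[E.indicator fun _ => a, F.indicator fun _ => c; μ] =
      a * c * (μ.real (E ∩ F) - μ.real E * μ.real F) := by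
  rw [covariance_eq_sub (memLp_indicator_const 2 hE a (Or.inr (measure_ne_top μ E)))
    (memLp_indicator_const 2 hF c (Or.inr (measure_ne_top μ F)))]
  have hprod : (E.indicator fun _ => a) * (F.indicator fun _ => c) =
      (E ∩ F).indicator fun _ => a * c := by
    funext z
    exact (Set.inter_indicator_mul (fun _ => a) (fun _ => c) z).symm
  rw [hprod, integral_indicator_const _ (hE.inter hF), integral_indicator_const _ hE,
    integral_indicator_const _ hF]
  simp only [smul_eq_mul]
  ring

/-- A variance bound from almost uncorrelated exposures at distance more than `4`, and lower bounds
on the exposure probabilities, which control the remaining pairs. -/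
theorem variance_htMean_le [Nonempty V] {μ : Measure (V → Bool)} [IsProbabilityMeasure μ]
    {Y : V → (V → Bool) → ℝ} (hY : FullNeighborhoodExposure G Y) {Ybar : ℝ}
    (hYbar : ∀ i z, Y i z ∈ Set.Icc 0 Ybar) {b : Bool} {η C M : ℝ} (hη : 0 ≤ η) (hC : 0 ≤ C)
    (hpos : ∀ i, 1 ≤ C * μ.real (exposed G b i))
    (hball : ∀ i, ((ball G 4 i).card : ℝ) ≤ M)
    (hfar : ∀ i j, j ∉ ball G 4 i → μ.real (exposed G b i ∩ exposed G b j) ≤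
      (1 + η) * (μ.real (exposed G b i) * μ.real (exposed G b j))) :
    variance (htMean G μ Y b) μ ≤ Ybar ^ 2 * (η + C * M / Fintype.card V) := by
  classical
  set n : ℝ := (Fintype.card V : ℝ) with hn
  have hn0 : 0 < n := by rw [hn]; exact_mod_cast Fintype.card_pos
  set P : V → ℝ := fun i => μ.real (exposed G b i)
  set y : V → ℝ := fun i => Y i fun _ => b
  have hP : ∀ i, 0 < P i := by
    intro i
    by_contra! h
    have h1 := hpos i
    nlinarith [mul_nonneg hC (neg_nonneg.2 h)]
  have hy : ∀ i, 0 ≤ y i ∧ y i ≤ Ybar := fun i => hYbar i _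
  have hYbar0 : 0 ≤ Ybar := by
    obtain ⟨i⟩ := ‹Nonempty V›
    exact (hy i).1.trans (hy i).2
  have hht : htMean G μ Y b = fun z => (1 / n) * ∑ i,
      (exposed G b i).indicator (fun _ => y i / P i) z := by
    funext z
    unfold htMean
    congr 1
    refine Finset.sum_congr rfl fun i _ => ?_
    by_cases hz : z ∈ exposed G b i
    · rw [if_pos hz, Set.indicator_of_mem hz, hY i b z hz]
    · rw [if_neg hz, Set.indicator_of_notMem hz]
  have hyy : ∀ i j, y i * y j ≤ Ybar ^ 2 := by
    intro i j
    rw [sq]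
    exact mul_le_mul (hy i).2 (hy j).2 (hy j).1 hYbar0
  have hcov : ∀ i j, cov[(exposed G b i).indicator fun _ => y i / P i,
      (exposed G b j).indicator fun _ => y j / P j; μ] ≤
      Ybar ^ 2 * (η + if j ∈ ball G 4 i then C else 0) := by
    intro i j
    rw [covariance_indicator_const (measurableSet_exposed b i) (measurableSet_exposed b j)]
    have ha : 0 ≤ y i / P i * (y j / P j) :=
      mul_nonneg (div_nonneg (hy i).1 (hP i).le) (div_nonneg (hy j).1 (hP j).le)
    have hPi := hP i
    have hPj := hP j
    split_ifs with hij
    · have h1 : μ.real (exposed G b i ∩ exposed G b j) - P i * P j ≤ P j := by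
        have := measureReal_mono (μ := μ) (Set.inter_subset_right (s := exposed G b i)
          (t := exposed G b j))
        have := mul_pos hPi hPj
        simp only [P] at *
        linarith
      have h2 : 1 / P i ≤ C := (div_le_iff₀ hPi).2 (hpos i)
      calc _ ≤ y i / P i * (y j / P j) * P j := mul_le_mul_of_nonneg_left h1 ha
        _ = y i * y j * (1 / P i) := by field_simp
        _ ≤ Ybar ^ 2 * C := mul_le_mul (hyy i j) h2 (by positivity) (by positivity)
        _ ≤ Ybar ^ 2 * (η + C) := by gcongr; exact le_add_of_nonneg_left hη
    · have h1 : μ.real (exposed G b i ∩ exposed G b j) - P i * P j ≤ η * (P i * P j) := by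
        have := hfar i j hij
        simp only [P] at *
        linarith
      calc _ ≤ y i / P i * (y j / P j) * (η * (P i * P j)) := mul_le_mul_of_nonneg_left h1 ha
        _ = y i * y j * η := by field_simp
        _ ≤ Ybar ^ 2 * (η + 0) := by rw [add_zero]; exact mul_le_mul_of_nonneg_right (hyy i j) hη
  rw [hht, variance_const_mul, variance_fun_sum fun i => memLp_of_finite _]
  have hsum : ∑ i, ∑ j, cov[(exposed G b i).indicator fun _ => y i / P i,
      (exposed G b j).indicator fun _ => y j / P j; μ] ≤
      n * (Ybar ^ 2 * (η * n + C * M)) := by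
    calc _ ≤ ∑ i : V, ∑ j : V, Ybar ^ 2 * (η + if j ∈ ball G 4 i then C else 0) :=
          Finset.sum_le_sum fun i _ => Finset.sum_le_sum fun j _ => hcov i j
      _ = ∑ i : V, Ybar ^ 2 * (η * n + C * (ball G 4 i).card) := by
          refine Finset.sum_congr rfl fun i _ => ?_
          rw [← Finset.mul_sum, Finset.sum_add_distrib, Finset.sum_ite_mem, Finset.univ_inter,
            Finset.sum_const, Finset.sum_const, Finset.card_univ, nsmul_eq_mul, nsmul_eq_mul,
            mul_comm η, mul_comm C]
      _ ≤ ∑ _i : V, Ybar ^ 2 * (η * n + C * M) := by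
          refine Finset.sum_le_sum fun i _ => ?_
          gcongr
          exact hball i
      _ = _ := by rw [Finset.sum_const, Finset.card_univ, nsmul_eq_mul]
  calc _ ≤ (1 / n) ^ 2 * (n * (Ybar ^ 2 * (η * n + C * M))) := by gcongr
    _ = Ybar ^ 2 * (η + C * M / n) := by field_simp

theorem variance_sub_le_two_mul {Ω : Type*} [MeasurableSpace Ω] {μ : Measure Ω}
    [IsFiniteMeasure μ] {X Z : Ω → ℝ} (hX : MemLp X 2 μ) (hZ : MemLp Z 2 μ) :
    variance (X - Z) μ ≤ 2 * variance X μ + 2 * variance Z μ := by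
  have h := variance_nonneg (X + Z) μ
  rw [variance_add hX hZ] at h
  rw [variance_sub hX hZ]
  linarith

theorem varGATE_le (R : Finset (Finset V) → PMF (Finset (Finset V)))
    (Y : V → (V → Bool) → ℝ) :
    varGATE G R Y ≤ 2 * variance (htMean G (design G R) Y true) (design G R) +
      2 * variance (htMean G (design G R) Y false) (design G R) :=
  variance_sub_le_two_mul (memLp_of_finite _) (memLp_of_finite _)

/-- The condition `hL` makes the term `q ^ L` of `idealProb_le` at most `ε` times the ideal exposure
probability, and `hT` makes the contribution of the pairs at distance at most `4` at most `3 ε`. -/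
theorem variance_htMean_design_le [Nonempty V] [DecidableRel G.Adj]
    {R : Finset (Finset V) → PMF (Finset (Finset V))} {b : Bool} {q ε K₀ κ : ℝ} {D L : ℕ}
    (hκ : HasRestrictedGrowth G κ)
    {Y : V → (V → Bool) → ℝ} (hY : FullNeighborhoodExposure G Y) {Ybar : ℝ}
    (hYbar : ∀ i z, Y i z ∈ Set.Icc 0 Ybar)
    (hR : NearlyIndependent R b q ε K₀ D L) (hq : q ∈ Set.Ioo (0 : ℝ) 1)
    (hε : ε ∈ Set.Ioc (0 : ℝ) (1 / 2))
    (hK : K₀ * (G.maxDegree + 1) ≤ Fintype.card V) (hD : 2 * (G.maxDegree + 1) ≤ D)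
    (hT : κ ^ 4 * (G.maxDegree + 1 : ℝ) ^ 2 ≤ q * ε * Fintype.card V)
    (hL : q ^ L * (κ * (G.maxDegree + 1 : ℝ)) ≤ q * ε) :
    variance (htMean G (design G R) Y b) (design G R) ≤ Ybar ^ 2 * (28 * ε) := by
  obtain ⟨hε0, hε1⟩ := hε
  obtain ⟨hq0, hq1⟩ := hq
  have hκ1 := hκ.one_le
  set d : ℝ := (G.maxDegree + 1 : ℝ) with hd
  have hd0 : 0 < d := by positivity
  have hκd : 0 < κ * d := by positivity
  set n : ℝ := (Fintype.card V : ℝ) with hn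
  have hn0 : 0 < n := by rw [hn]; exact_mod_cast Fintype.card_pos
  set P : V → ℝ := fun i => (design G R).real (exposed G b i)
  set w : V → ℝ := fun i => (idealProb G q i).toReal
  have hwtop : ∀ i, idealProb G q i ≠ ⊤ := fun i =>
    ((idealProb_le_one hq1.le i).trans_lt ENNReal.one_lt_top).ne
  have hw0 : ∀ i, 0 ≤ w i := fun i => ENNReal.toReal_nonneg
  have hP0 : ∀ i, 0 ≤ P i := fun i => measureReal_nonneg
  have hqw : ∀ i, q ≤ κ * d * w i := by
    intro i
    have h := ENNReal.toReal_mono (ENNReal.mul_ne_top (ENNReal.natCast_ne_top _) (hwtop i))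
      (ofReal_le_card_mul_idealProb G q i)
    rw [ENNReal.toReal_ofReal hq0.le, ENNReal.toReal_mul, ENNReal.toReal_natCast] at h
    have h2 := hκ.card_ball_le i 1
    rw [pow_one] at h2
    exact h.trans (mul_le_mul_of_nonneg_right h2 (hw0 i))
  have hwP : ∀ i, w i ≤ (1 + 4 * ε) * P i := by
    intro i
    have h := ENNReal.toReal_mono (ENNReal.add_ne_top.2 ⟨ENNReal.pow_ne_top ENNReal.ofReal_ne_top,
      ENNReal.mul_ne_top ENNReal.ofReal_ne_top (measure_ne_top _ _)⟩) (idealProb_le hR hK hq1.le i)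
    rw [ENNReal.toReal_add (ENNReal.pow_ne_top ENNReal.ofReal_ne_top)
      (ENNReal.mul_ne_top ENNReal.ofReal_ne_top (measure_ne_top _ _)), ENNReal.toReal_mul,
      ENNReal.toReal_pow, ENNReal.toReal_ofReal hq0.le, ENNReal.toReal_ofReal (by linarith)] at h
    have h' : w i ≤ q ^ L + (1 + ε) * P i := h
    have hLw : q ^ L ≤ ε * w i := by
      refine le_of_mul_le_mul_right ?_ hκd
      calc q ^ L * (κ * d) ≤ q * ε := hL
        _ ≤ κ * d * w i * ε := by gcongr; exact hqw i
        _ = ε * w i * (κ * d) := by ring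
    have h3 : (1 - ε) * w i ≤ (1 + ε) * P i := by linarith
    have h4 : 1 + ε ≤ (1 - ε) * (1 + 4 * ε) := by nlinarith
    refine le_of_mul_le_mul_left (h3.trans ?_) (by linarith : 0 < 1 - ε)
    calc (1 + ε) * P i ≤ ((1 - ε) * (1 + 4 * ε)) * P i := mul_le_mul_of_nonneg_right h4 (hP0 i)
      _ = _ := by ring
  have hpos : ∀ i, 1 ≤ 3 * (κ * d) / q * P i := by
    intro i
    rw [div_mul_eq_mul_div, le_div_iff₀ hq0, one_mul]
    calc q ≤ κ * d * w i := hqw i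
      _ ≤ κ * d * ((1 + 4 * ε) * P i) := by gcongr; exact hwP i
      _ ≤ κ * d * (3 * P i) := by gcongr; linarith
      _ = _ := by ring
  have hfar : ∀ i j, j ∉ ball G 4 i →
      (design G R).real (exposed G b i ∩ exposed G b j) ≤ (1 + 25 * ε) * (P i * P j) := by
    intro i j hij
    have h := ENNReal.toReal_mono (ENNReal.mul_ne_top ENNReal.ofReal_ne_top
      (ENNReal.mul_ne_top (hwtop i) (hwtop j))) (design_inter_exposed_le hR hK hD hij)
    rw [ENNReal.toReal_mul, ENNReal.toReal_mul, ENNReal.toReal_ofReal (by linarith)] at h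
    calc (design G R).real (exposed G b i ∩ exposed G b j) ≤ (1 + ε) * (w i * w j) := h
      _ ≤ (1 + ε) * (((1 + 4 * ε) * P i) * ((1 + 4 * ε) * P j)) := by
          gcongr
          · exact hwP i
          · exact hwP j
      _ = ((1 + ε) * (1 + 4 * ε) ^ 2) * (P i * P j) := by ring
      _ ≤ (1 + 25 * ε) * (P i * P j) := by
          refine mul_le_mul_of_nonneg_right ?_ (mul_nonneg (hP0 i) (hP0 j))
          have h2 : ε ^ 2 ≤ ε / 2 := by nlinarith
          have h3 : ε ^ 3 ≤ ε / 4 := by nlinarith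
          nlinarith
  refine (variance_htMean_le hY hYbar (by positivity) (by positivity) hpos
    (fun i => hκ.card_ball_le i 3) hfar).trans ?_
  refine mul_le_mul_of_nonneg_left ?_ (sq_nonneg _)
  have h : 3 * (κ * d) / q * (κ ^ 3 * d) / n ≤ 3 * ε := by
    rw [div_le_iff₀ hn0, div_mul_eq_mul_div, div_le_iff₀ hq0]
    calc 3 * (κ * d) * (κ ^ 3 * d) = 3 * (κ ^ 4 * d ^ 2) := by ring
      _ ≤ 3 * (q * ε * n) := by gcongr
      _ = _ := by ring
  linarith

end Variance

/-! ### The limit -/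

section Limit

variable {G : (n : ℕ) → SimpleGraph (Fin n)} [∀ n, DecidableRel (G n).Adj] {κ : ℕ → ℝ}

theorem tendsto_growth_of_isLittleO_six
    (h1 : κ =o[atTop] fun n : ℕ => (n : ℝ) ^ (1 / 6 : ℝ))
    (h2 : (fun n => ((G n).maxDegree : ℝ)) =o[atTop] fun n : ℕ => (n : ℝ) ^ (1 / 6 : ℝ)) :
    Tendsto (fun n => κ n ^ 4 * ((G n).maxDegree + 1 : ℝ) ^ 2 / n) atTop (𝓝 0) := by
  have h3 : (fun _ : ℕ => (1 : ℝ)) =o[atTop] fun n : ℕ => (n : ℝ) ^ (1 / 6 : ℝ) :=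
    (isLittleO_const_left.2 (Or.inr (tendsto_norm_atTop_atTop.comp
      ((tendsto_rpow_atTop (by norm_num)).comp tendsto_natCast_atTop_atTop))))
  have h := ((h1.tendsto_div_nhds_zero.pow 4).mul ((h2.add h3).tendsto_div_nhds_zero.pow 2))
  simp only [ne_eq, OfNat.ofNat_ne_zero, not_false_eq_true, zero_pow, mul_zero] at h
  refine h.congr fun n => ?_
  rw [div_pow, div_pow, div_mul_div_comm, ← pow_add]
  congr 1
  rw [← Real.rpow_natCast, ← Real.rpow_mul (Nat.cast_nonneg n)]
  norm_num

theorem tendsto_growth_of_isLittleO_two (hκ : ∃ κ₀ : ℝ, ∀ n, κ n = κ₀)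
    (h2 : (fun n => ((G n).maxDegree : ℝ)) =o[atTop] fun n : ℕ => (n : ℝ) ^ (1 / 2 : ℝ)) :
    Tendsto (fun n => κ n ^ 4 * ((G n).maxDegree + 1 : ℝ) ^ 2 / n) atTop (𝓝 0) := by
  obtain ⟨κ₀, hκ⟩ := hκ
  have h3 : (fun _ : ℕ => (1 : ℝ)) =o[atTop] fun n : ℕ => (n : ℝ) ^ (1 / 2 : ℝ) :=
    (isLittleO_const_left.2 (Or.inr (tendsto_norm_atTop_atTop.comp
      ((tendsto_rpow_atTop (by norm_num)).comp tendsto_natCast_atTop_atTop))))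
  have h := ((h2.add h3).tendsto_div_nhds_zero.pow 2).const_mul (κ₀ ^ 4)
  simp only [ne_eq, OfNat.ofNat_ne_zero, not_false_eq_true, zero_pow, mul_zero] at h
  refine h.congr fun n => ?_
  rw [div_pow, hκ n, mul_div_assoc]
  congr 2
  rw [← Real.rpow_natCast, ← Real.rpow_mul (Nat.cast_nonneg n)]
  norm_num

theorem sqrt_sqrt_pow_four_le (n : ℕ) : n.sqrt.sqrt ^ 4 ≤ n := by
  calc n.sqrt.sqrt ^ 4 = (n.sqrt.sqrt ^ 2) ^ 2 := by ring
    _ ≤ n.sqrt ^ 2 := Nat.pow_le_pow_left (Nat.sqrt_le' _) 2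
    _ ≤ n := Nat.sqrt_le' n

theorem le_sqrt_sqrt_add_one_pow_four (n : ℕ) : n ≤ (n.sqrt.sqrt + 1) ^ 4 := by
  calc n ≤ (n.sqrt + 1) ^ 2 := (Nat.lt_succ_sqrt' n).le
    _ ≤ ((n.sqrt.sqrt + 1) ^ 2) ^ 2 := Nat.pow_le_pow_left (Nat.lt_succ_sqrt' n.sqrt) 2
    _ = _ := by ring

theorem tendsto_pow_sqrt_sqrt_mul {q : ℝ} (hq : q ∈ Set.Ioo (0 : ℝ) 1) :
    Tendsto (fun n : ℕ => q ^ n.sqrt.sqrt * (n : ℝ)) atTop (𝓝 0) := by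
  have h1 : Tendsto (fun L : ℕ => ((L + 1 : ℕ) : ℝ) ^ 4 * q ^ (L + 1) * q⁻¹) atTop (𝓝 0) := by
    have := ((tendsto_add_atTop_iff_nat 1).2 (tendsto_pow_const_mul_const_pow_of_abs_lt_one 4
      (abs_lt.2 ⟨by linarith [hq.1], hq.2⟩))).mul_const q⁻¹
    simpa using this
  have hs : Tendsto Nat.sqrt atTop atTop := by
    refine tendsto_atTop.2 fun m => ?_
    filter_upwards [eventually_ge_atTop (m * m)] with n hn using Nat.le_sqrt.2 hn
  refine squeeze_zero (fun n => by have := hq.1; positivity) (fun n => ?_)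
    (h1.comp (hs.comp hs))
  have hq0 := hq.1
  have h : (n : ℝ) ≤ ((n.sqrt.sqrt + 1 : ℕ) : ℝ) ^ 4 := by
    exact_mod_cast le_sqrt_sqrt_add_one_pow_four n
  calc q ^ n.sqrt.sqrt * (n : ℝ) ≤ q ^ n.sqrt.sqrt * ((n.sqrt.sqrt + 1 : ℕ) : ℝ) ^ 4 := by gcongr
    _ = _ := by
      simp only [Function.comp_apply, pow_succ q]
      field_simp

/-- The condition `κ⁴ (d_max + 1)² = o(n)` suffices. As `κ ≥ 1`, it also gives
`κ (d_max + 1) ≤ n` for large `n`, which makes `q ^ L κ (d_max + 1)` small for `L` of order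
`n ^ (1 / 4)`. -/
theorem tendsto_varGATE_of_nearlyIndependent
    (hκ : ∀ n, HasRestrictedGrowth (G n) (κ n))
    {Y : (n : ℕ) → Fin n → (Fin n → Bool) → ℝ} (hY : ∀ n, FullNeighborhoodExposure (G n) (Y n))
    {Ybar : ℝ} (hYbar : ∀ n i z, Y n i z ∈ Set.Icc 0 Ybar) {p : ℝ} (hp : p ∈ Set.Ioo (0 : ℝ) 1)
    (hT : Tendsto (fun n => κ n ^ 4 * ((G n).maxDegree + 1 : ℝ) ^ 2 / n) atTop (𝓝 0))
    {R : (n : ℕ) → Finset (Finset (Fin n)) → PMF (Finset (Finset (Fin n)))}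
    (hR : ∀ ε ∈ Set.Ioc (0 : ℝ) (1 / 2), ∀ b, ∀ᶠ n in atTop,
      NearlyIndependent (R n) b (armProb p b) ε (n / ((G n).maxDegree + 1))
        (2 * ((G n).maxDegree + 1)) n.sqrt.sqrt) :
    Tendsto (fun n => varGATE (G n) (R n) (Y n)) atTop (𝓝 0) := by
  have key : ∀ ε ∈ Set.Ioc (0 : ℝ) (1 / 2), ∀ b, ∀ᶠ n in atTop,
      variance (htMean (G n) (design (G n) (R n)) (Y n) b) (design (G n) (R n)) ≤
        Ybar ^ 2 * (28 * ε) := by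
    intro ε hε b
    have hq := armProb_mem_Ioo hp b
    set q := armProb p b
    have hqε : 0 < q * ε := mul_pos hq.1 hε.1
    filter_upwards [hR ε hε b, eventually_gt_atTop 0, hT.eventually_le_const hqε,
      hT.eventually_le_const one_pos,
      (tendsto_pow_sqrt_sqrt_mul hq).eventually_le_const hqε] with n hRn hn hT1 hT2 hLn
    have : Nonempty (Fin n) := ⟨⟨0, hn⟩⟩
    have hn0 : (0 : ℝ) < n := by exact_mod_cast hn
    have hκ1 := (hκ n).one_le
    set d : ℝ := ((G n).maxDegree + 1 : ℝ) with hd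
    have hd1 : 1 ≤ d := by rw [hd]; linarith [Nat.cast_nonneg (α := ℝ) (G n).maxDegree]
    rw [div_le_iff₀ hn0] at hT1 hT2
    have hκd : κ n * d ≤ n := by
      calc κ n * d ≤ κ n ^ 4 * d ^ 2 := by
            gcongr
            · exact le_self_pow₀ hκ1 (by norm_num)
            · exact le_self_pow₀ hd1 (by norm_num)
        _ ≤ n := by linarith
    refine variance_htMean_design_le (hκ n) (hY n) (hYbar n) hRn hq hε ?_ le_rfl ?_ ?_
    · rw [Fintype.card_fin, div_mul_cancel₀ _ (by positivity)]
    · rwa [Fintype.card_fin]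
    · refine le_trans ?_ hLn
      have := hq.1
      gcongr
  refine tendsto_order.2 ⟨fun a ha => Eventually.of_forall fun n =>
    ha.trans_le (variance_nonneg _ _), fun a ha => ?_⟩
  -- Each of the two arms contributes `2 · 28 Ybar² ε` to the bound.
  set ε : ℝ := min (1 / 2) (a / (113 * (Ybar ^ 2 + 1))) with hεdef
  have hε : ε ∈ Set.Ioc (0 : ℝ) (1 / 2) := ⟨by positivity, min_le_left _ _⟩
  have hlt : 112 * Ybar ^ 2 * ε < a := by
    have h1 : ε * (113 * (Ybar ^ 2 + 1)) ≤ a := by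
      rw [← le_div_iff₀ (by positivity)]
      exact min_le_right _ _
    nlinarith [hε.1, sq_nonneg Ybar]
  filter_upwards [key ε hε true, key ε hε false] with n h1 h2
  refine (varGATE_le (R n) (Y n)).trans_lt ?_
  linarith

/-- With `L` of order `n ^ (1 / 4)`, both `D / K₀ = 2 (d_max + 1) ^ 2 / n` and the square of
`L ^ 2 / K₀`, which is at most `(d_max + 1) ^ 2 / n`, tend to zero. -/
theorem eventually_nearlyIndependent_complete (hκ : ∀ n, HasRestrictedGrowth (G n) (κ n))
    {p : ℝ} (hp : p ∈ Set.Ioo (0 : ℝ) 1)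
    (hT : Tendsto (fun n => κ n ^ 4 * ((G n).maxDegree + 1 : ℝ) ^ 2 / n) atTop (𝓝 0))
    {N : ℕ → ℕ → PMF ℕ} (hN : ∀ n, IsCompleteRule p (N n)) {ε : ℝ}
    (hε : ε ∈ Set.Ioc (0 : ℝ) (1 / 2)) (b : Bool) :
    ∀ᶠ n in atTop, NearlyIndependent (complete (α := Finset (Fin n)) (N n)) b (armProb p b) ε
      (n / ((G n).maxDegree + 1)) (2 * ((G n).maxDegree + 1)) n.sqrt.sqrt := by
  have hq := (armProb_mem_Ioo hp b).1
  set q := armProb p b with hqdef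
  have hlog : 0 < Real.log (1 + ε) := Real.log_pos (by linarith [hε.1])
  have hδ : 0 < q * (ε / 2) := mul_pos hq (half_pos hε.1)
  filter_upwards [eventually_gt_atTop 0,
    hT.eventually_le_const (show 0 < q / 2 * Real.log (1 + ε) by positivity),
    hT.eventually_le_const (show 0 < (q * (ε / 2)) ^ 2 by positivity)] with n hn h1 h2
  have : Nonempty (Fin n) := ⟨⟨0, hn⟩⟩
  have hn0 : (0 : ℝ) < n := by exact_mod_cast hn
  have hκ1 := (hκ n).one_le
  set d : ℝ := ((G n).maxDegree + 1 : ℝ) with hd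
  have hd0 : 0 < d := by positivity
  have hd2 : d ^ 2 / n ≤ κ n ^ 4 * d ^ 2 / n := by
    gcongr
    exact le_mul_of_one_le_left (by positivity) (one_le_pow₀ hκ1)
  refine nearlyIndependent_complete hp b (hN n) hε.1.le (by positivity) ?_ ?_
  · rw [← Real.le_log_iff_exp_le (by linarith [hε.1])]
    have heq : ((2 * ((G n).maxDegree + 1) : ℕ) : ℝ) / (q * (n / d)) = 2 / q * (d ^ 2 / n) := by
      push_cast
      rw [← hd]
      field_simp
    rw [← hqdef, heq]
    calc 2 / q * (d ^ 2 / n) ≤ 2 / q * (q / 2 * Real.log (1 + ε)) := by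
          gcongr
          exact hd2.trans h1
      _ = Real.log (1 + ε) := by field_simp
  · rw [← hqdef]
    set L : ℝ := (n.sqrt.sqrt : ℝ) with hLdef
    have hL4 : L ^ 4 ≤ n := by
      rw [hLdef]
      exact_mod_cast sqrt_sqrt_pow_four_le n
    have hx : L ^ 2 * d / n ≤ q * (ε / 2) := by
      refine le_of_sq_le_sq ?_ hδ.le
      calc (L ^ 2 * d / n) ^ 2 = L ^ 4 / n * (d ^ 2 / n) := by field_simp
        _ ≤ 1 * (d ^ 2 / n) := by
            gcongr
            exact (div_le_one hn0).2 hL4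
        _ ≤ _ := by rw [one_mul]; exact hd2.trans h2
    have heq : L ^ 2 / (q * (n / d)) = (L ^ 2 * d / n) / q := by field_simp
    have hle : L ^ 2 / (q * (n / d)) ≤ ε / 2 := by
      rw [heq, div_le_iff₀ hq, mul_comm (ε / 2)]
      exact hx
    nlinarith [hε.1, hε.2]

end Limit

end RGCR

theorem mainTheorem4
    (G : (n : ℕ) → SimpleGraph (Fin n)) [∀ n, DecidableRel (G n).Adj]
    (κ : ℕ → ℝ) (hκ : ∀ n, RGCR.HasRestrictedGrowth (G n) (κ n))
    (Y : (n : ℕ) → Fin n → (Fin n → Bool) → ℝ)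
    (hY : ∀ n, RGCR.FullNeighborhoodExposure (G n) (Y n))
    (Ybar : ℝ) (hYbar : ∀ n i z, Y n i z ∈ Set.Icc 0 Ybar)
    (p : ℝ) (hp : p ∈ Set.Ioo (0 : ℝ) 1)
    (hgrowth :
      ((∃ κ₀ : ℝ, ∀ n, κ n = κ₀) ∧
        (fun n => ((G n).maxDegree : ℝ)) =o[atTop] (fun n : ℕ => (n : ℝ) ^ (1 / 2 : ℝ))) ∨
      (κ =o[atTop] (fun n : ℕ => (n : ℝ) ^ (1 / 6 : ℝ)) ∧
        (fun n => ((G n).maxDegree : ℝ)) =o[atTop] (fun n : ℕ => (n : ℝ) ^ (1 / 6 : ℝ)))) :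
    Tendsto (fun n => RGCR.varGATE (G n) (RGCR.independent p hp) (Y n)) atTop (𝓝 0) ∧
    ∀ N : ℕ → ℕ → PMF ℕ, (∀ n, RGCR.IsCompleteRule p (N n)) →
      Tendsto (fun n => RGCR.varGATE (G n) (RGCR.complete (N n)) (Y n)) atTop (𝓝 0) := by
  have hT : Tendsto (fun n => κ n ^ 4 * ((G n).maxDegree + 1 : ℝ) ^ 2 / n) atTop (𝓝 0) := by
    rcases hgrowth with ⟨h1, h2⟩ | ⟨h1, h2⟩
    · exact RGCR.tendsto_growth_of_isLittleO_two h1 h2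
    · exact RGCR.tendsto_growth_of_isLittleO_six h1 h2
  exact ⟨RGCR.tendsto_varGATE_of_nearlyIndependent hκ hY hYbar hp hT fun ε hε b =>
      Eventually.of_forall fun n => RGCR.nearlyIndependent_independent hp b hε.1.le _ _ _,
    fun N hN => RGCR.tendsto_varGATE_of_nearlyIndependent hκ hY hYbar hp hT fun ε hε b =>
      RGCR.eventually_nearlyIndependent_complete hκ hp hT hN hε b⟩
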